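/- Let $G$ be a connected undirected graph on $N\ge 2$ vertices without loops, with real edge weights $w_{ij}=w_{ji}$ (non-zero exactly on the edges), and let $L=D-W$ be its combinatorial Laplacian, where $W=(w_{ij})$ and $D$ is the diagonal matrix of the weighted degrees $\sum_j w_{ij}$. Write the eigenvalues of $L$, with multiplicity, in increasing order as $\lambda_1\le\lambda_2\le\dots\le\lambda_N$. Assume that all weights are non-negative or, more generally, that $L$ is positive semidefinite and $\lambda_2>0$. Let $\mu>0$, let $S$ be a non-empty set of vertices, and let $m=|S|$. Let $\Pi_S$ be the diagonal $0$-$1$ matrix of the coordinate projection onto $S$, and let $$R_S=\big[(\Pi_S+\mu L)^{-1}\big]_{\mathcal N,S}$$ be the matrix formed by the columns of $(\Pi_S+\mu L)^{-1}$ indexed by $S$ (the matrix of graph-Laplacian regularised reconstruction, which maps $y\in\mathbb R^{S}$ to the minimiser of $\|x_S-y\|_2^2+\mu\,x^{T}Lx$ over $x\in\mathbb R^N$). Let $\xi_2(S)=\|R_S\|_F^2$ (Frobenius norm) be its noise sensitivity under full-band noise. Put $$\omega(x)=\tfrac14\Big(\sqrt x+\tfrac1{\sqrt x}\Big)^2\quad(x>0),\qquad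 r=\omega\Big(\frac{\lambda_N}{\lambda_2}\Big).$$ Then $$\xi_2(S)\;\le\; r\,\frac Nm+\sum_{i=2}^{m}\omega\Big(\max\Big[1,\frac{\lambda_{N+2-i}}{\lambda_i}\Big]\Big)\;\le\; r\,\frac Nm+r\,(m-1),$$ where the sum is $0$ if $m=1$. -/

import Mathlib

open Finset

/-- A finite undirected graph with real edge weights and without loops; a pair of vertices is an
edge exactly if its weight is non-zero. -/
structure WeightedGraph (V : Type*) where
  /-- the weighted adjacency matrix -/
  weight : Matrix V V ℝ
  symm : weight.IsSymm
  loopless : ∀ v, weight v v = 0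

namespace WeightedGraph

variable {V : Type*}

/-- The underlying simple graph: `i` and `j` are adjacent if the weight of the pair is non-zero. -/
def support (G : WeightedGraph V) : SimpleGraph V where
  Adj i j := G.weight i j ≠ 0
  symm := ⟨fun i j h => by rwa [G.symm.apply i j]⟩
  loopless := ⟨fun i h => h (G.loopless i)⟩

variable [Fintype V] [DecidableEq V]

/-- The combinatorial Laplacian `D - W`, where `D` is the diagonal matrix of weighted degrees. -/
def laplacian (G : WeightedGraph V) : Matrix V V ℝ :=
  Matrix.diagonal (fun i => ∑ j, G.weight i j) - G.weight

theorem laplacian_isHermitian (G : WeightedGraph V) : G.laplacian.IsHermitian := by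
  have h : G.weight.IsHermitian := by
    rw [Matrix.IsHermitian, Matrix.conjTranspose_eq_transpose_of_trivial]
    exact G.symm
  exact (Matrix.isHermitian_diagonal _).sub h

/-- The eigenvalues of the Laplacian, with multiplicity, in increasing order and numbered from `1`:
`G.eig 1 ≤ G.eig 2 ≤ … ≤ G.eig N`, where `N` is the number of vertices.
(Mathlib's `eigenvalues₀` is the decreasing list, numbered from `0`.)
The value is `0` for a number outside `1, …, N`. -/
noncomputable def eig (G : WeightedGraph V) (k : ℕ) : ℝ :=
  if h : 1 ≤ k ∧ k ≤ Fintype.card V then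
    G.laplacian_isHermitian.eigenvalues₀ ⟨Fintype.card V - k, by omega⟩
  else 0

/-- The matrix `R_S` of graph-Laplacian regularised reconstruction with parameter `μ` from
observations on `S`: the columns of `(Π_S + μ L)⁻¹` with index in `S`, where `Π_S` is the
coordinate projection onto `S`. -/
noncomputable def glrMatrix (G : WeightedGraph V) (μ : ℝ) (S : Finset V) : Matrix V S ℝ :=
  (Matrix.diagonal (fun i => if i ∈ S then (1 : ℝ) else 0) + μ • G.laplacian)⁻¹.submatrix
    id (fun s : S => (s : V))

/-- The noise sensitivity `ξ₂(S) = ‖R_S‖_F²` of graph-Laplacian regularised reconstruction under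
full-band noise. -/
noncomputable def noiseSensitivity (G : WeightedGraph V) (μ : ℝ) (S : Finset V) : ℝ :=
  ∑ i : V, ∑ s : S, (G.glrMatrix μ S i s) ^ 2

end WeightedGraph

/-- The Kantorovich function `ω(x) = (√x + 1/√x)² / 4`. -/
noncomputable def kantorovichOmega (x : ℝ) : ℝ :=
  1 / 4 * (√x + 1 / √x) ^ 2

/-! Write `A` for the Laplacian, `E` for the projection onto `S`, `u` for the constant vector, `B`
for `(E + μA)⁻¹`, so that `ξ₂(S) = ‖BE‖_F²`. As `λ₂ > 0`, the kernel of `A` is spanned by `u`.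

Reduction to harmonic extension. Every `BEx` is harmonic off `S`, so `BE = HX`, where `H` is
harmonic extension from `S` and `X = EBE` is a symmetric contraction; hence `‖BE‖_F ≤ ‖H‖_F` for
every `μ`. Here `H` is an `A`-selfadjoint projection of rank `m` fixing `u`. Removing its component
along `u` leaves an `A`-selfadjoint projection `P` of rank `p = m - 1`, living on the complement of
`u`, and `‖H‖_F² = ‖P‖_F² + ‖H*u‖²/N`.

The component along `u`. Kantorovich's inequality gives `‖Pw‖² ≤ r‖w‖²` for the vector `w = P*Eu`,
whence `‖H*u‖²/N ≤ rN/m`.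

The part `P` (`exists_substochastic_of_projection`). In an eigenbasis of the compression of `A` to
`range P + range P*`, the reflection `2P - 1` has entries `κ` for which `κ s t * κ t s` is a
symmetric doubly stochastic matrix. Convexity of `1/x` then bounds `4‖P‖_F² - 4p` by `∑ d i j (α j /
α i - 1)`, with `α` the eigenvalues of `A` and `d` symmetric, doubly substochastic, of total weight
at most `2p`.

Optimisation over `d` (`sum_mul_ratio_sub_one_le`). The symmetrised cost is a nonnegative
combination of indicators of quadrants above the diagonal, and the truncated antidiagonal has the
largest mass admissible in all of them at once. So pairing `λ_i` with `λ_{N+2-i}` is optimal, which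
gives the sum of values of `ω`. -/

/-! ### Optimal pairing for symmetric substochastic weights -/

/-- A nonnegative combination of the indicators of the quadrants `{(i, j) | i ≤ a, b < j}`: if the
weight of every quadrant is at most that of the antidiagonal truncated at `p`, so is the total. -/
theorem sum_mul_le_sum_antidiagonal_of_quadrants {n p : ℕ} (hp : p ≤ n) (φ Δ d : ℕ → ℕ → ℝ)
    (hφ : ∀ i < n, ∀ j < n, φ i j =
      ∑ a ∈ range n, ∑ b ∈ range n, if i ≤ a ∧ b < j then Δ a b else 0)
    (hΔ : ∀ a < n, ∀ b < n, 0 ≤ Δ a b)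
    (hq : ∀ a < n, ∀ b < n, Δ a b ≠ 0 →
      (∑ i ∈ range n, ∑ j ∈ range n, if i ≤ a ∧ b < j then d i j else 0) ≤
        ∑ l ∈ range p, if l ≤ a ∧ b < n - 1 - l then (1 : ℝ) else 0) :
    ∑ i ∈ range n, ∑ j ∈ range n, d i j * φ i j ≤ ∑ l ∈ range p, φ l (n - 1 - l) := by
  have h1 : ∑ i ∈ range n, ∑ j ∈ range n, d i j * φ i j = ∑ a ∈ range n, ∑ b ∈ range n,
      Δ a b * ∑ i ∈ range n, ∑ j ∈ range n, if i ≤ a ∧ b < j then d i j else 0 := by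
    calc _ = ∑ i ∈ range n, ∑ j ∈ range n, ∑ a ∈ range n, ∑ b ∈ range n,
          Δ a b * if i ≤ a ∧ b < j then d i j else 0 := by
          refine sum_congr rfl fun i hi => sum_congr rfl fun j hj => ?_
          rw [hφ i (mem_range.1 hi) j (mem_range.1 hj), mul_sum]
          refine sum_congr rfl fun a _ => ?_
          rw [mul_sum]
          refine sum_congr rfl fun b _ => ?_
          split_ifs <;> ring
      _ = ∑ i ∈ range n, ∑ a ∈ range n, ∑ b ∈ range n, ∑ j ∈ range n,
          Δ a b * if i ≤ a ∧ b < j then d i j else 0 := by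
          refine sum_congr rfl fun i _ => ?_
          rw [sum_comm]
          exact sum_congr rfl fun a _ => sum_comm
      _ = _ := by
          rw [sum_comm]
          refine sum_congr rfl fun a _ => ?_
          rw [sum_comm]
          refine sum_congr rfl fun b _ => ?_
          simp_rw [mul_sum]
  have h2 : ∑ l ∈ range p, φ l (n - 1 - l) = ∑ a ∈ range n, ∑ b ∈ range n,
      Δ a b * ∑ l ∈ range p, if l ≤ a ∧ b < n - 1 - l then (1 : ℝ) else 0 := by
    calc _ = ∑ l ∈ range p, ∑ a ∈ range n, ∑ b ∈ range n,
          Δ a b * if l ≤ a ∧ b < n - 1 - l then (1 : ℝ) else 0 := by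
          refine sum_congr rfl fun l hl => ?_
          have := mem_range.1 hl
          rw [hφ l (by omega) _ (by omega)]
          refine sum_congr rfl fun a _ => sum_congr rfl fun b _ => ?_
          split_ifs <;> ring
      _ = _ := by
          rw [sum_comm]
          refine sum_congr rfl fun a _ => ?_
          rw [sum_comm]
          refine sum_congr rfl fun b _ => ?_
          rw [mul_sum]
  rw [h1, h2]
  refine sum_le_sum fun a ha => sum_le_sum fun b hb => ?_
  rcases eq_or_ne (Δ a b) 0 with h | h
  · simp [h]
  · exact mul_le_mul_of_nonneg_left (hq a (mem_range.1 ha) b (mem_range.1 hb) h)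
      (hΔ a (mem_range.1 ha) b (mem_range.1 hb))

/-- Two-dimensional telescoping for a function vanishing for `i ≥ j`. -/
theorem eq_sum_mixed_difference {n : ℕ} (φ : ℕ → ℕ → ℝ) (h0 : ∀ i j, j ≤ i → φ i j = 0)
    {i j : ℕ} (hi : i < n) (hj : j < n) :
    φ i j = ∑ a ∈ range n, ∑ b ∈ range n, if i ≤ a ∧ b < j then
      (φ a (b + 1) - φ a b - φ (a + 1) (b + 1) + φ (a + 1) b) else 0 := by
  have hb : ∀ a, (∑ b ∈ range n, if b < j then
      (φ a (b + 1) - φ a b - φ (a + 1) (b + 1) + φ (a + 1) b) else 0) = φ a j - φ (a + 1) j := by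
    intro a
    rw [← sum_filter]
    have : (range n).filter (fun b => b < j) = range j := by
      ext b; simp only [mem_filter, mem_range]; omega
    rw [this]
    have := sum_range_sub (fun b => φ a b - φ (a + 1) b) j
    rw [h0 a 0 (Nat.zero_le _), h0 (a + 1) 0 (Nat.zero_le _)] at this
    rw [sub_zero, sub_zero] at this
    rw [← this]
    exact sum_congr rfl fun b _ => by ring
  have : ∀ a ∈ range n, (∑ b ∈ range n, if i ≤ a ∧ b < j then
      (φ a (b + 1) - φ a b - φ (a + 1) (b + 1) + φ (a + 1) b) else 0) =
      if i ≤ a then φ a j - φ (a + 1) j else 0 := by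
    intro a _
    split_ifs with h
    · rw [← hb a]; simp [h]
    · simp [h]
  rw [sum_congr rfl this, ← sum_filter]
  have hf : (range n).filter (fun a => i ≤ a) = Ico i n := by
    ext a; simp only [mem_filter, mem_range, mem_Ico]; omega
  rw [hf, ← neg_inj, ← sum_neg_distrib]
  simp_rw [neg_sub]
  rw [sum_Ico_sub (fun a => φ a j) hi.le, h0 n j hj.le]
  ring

/-- Among the symmetric doubly substochastic matrices of total weight at most `2p`, the sum of
`β j / β i - 1` is largest when the extreme values are paired off. -/
theorem sum_mul_ratio_sub_one_le {n p : ℕ} (hp : p ≤ n) (β : ℕ → ℝ) (d : ℕ → ℕ → ℝ)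
    (hpos : ∀ i < n, 0 < β i) (hanti : ∀ i j, i ≤ j → j < n → β j ≤ β i)
    (hd : ∀ i j, 0 ≤ d i j) (hsymm : ∀ i j, d i j = d j i)
    (hrow : ∀ i < n, ∑ j ∈ range n, d i j ≤ 1)
    (htot : ∑ i ∈ range n, ∑ j ∈ range n, d i j ≤ 2 * p) :
    ∑ i ∈ range n, ∑ j ∈ range n, d i j * (β j / β i - 1) ≤
      ∑ l ∈ range p, if l ≤ n - 1 - l then
        β l / β (n - 1 - l) + β (n - 1 - l) / β l - 2 else 0 := by
  set g : ℕ → ℕ → ℝ := fun i j => β i / β j + β j / β i - 2 with hg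
  set φ : ℕ → ℕ → ℝ := fun i j => if i < j then g i j else 0 with hφ
  have hgnn : ∀ i < n, ∀ j < n, 0 ≤ g i j := by
    intro i hi j hj
    have hi' := hpos i hi
    have hj' := hpos j hj
    have : g i j = (β i - β j) ^ 2 / (β i * β j) := by
      simp only [hg]; field_simp; ring
    rw [this]; positivity
  have hgself : ∀ i < n, g i i = 0 := by
    intro i hi
    have := (hpos i hi).ne'
    simp only [hg]; field_simp; norm_num
  have hφ0 : ∀ i j, j ≤ i → φ i j = 0 := fun i j h => if_neg (by omega)
  have hφle : ∀ i j, i < n → i ≤ j → φ i j = g i j := by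
    intro i j hi h
    rcases h.eq_or_lt with rfl | h
    · rw [hφ0 i i le_rfl, hgself i hi]
    · exact if_pos h
  -- fold the symmetric sum onto the upper triangle
  have hfold : ∑ i ∈ range n, ∑ j ∈ range n, d i j * (β j / β i - 1) =
      ∑ i ∈ range n, ∑ j ∈ range n, d i j * φ i j := by
    have e1 : ∑ i ∈ range n, ∑ j ∈ range n, d i j * (β j / β i - 1) =
        ∑ i ∈ range n, ∑ j ∈ range n, d i j * (β i / β j - 1) := by
      rw [sum_comm]
      exact sum_congr rfl fun i _ => sum_congr rfl fun j _ => by rw [hsymm]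
    have e2 : ∑ i ∈ range n, ∑ j ∈ range n, d i j * φ i j =
        ∑ i ∈ range n, ∑ j ∈ range n, d i j * φ j i := by
      rw [sum_comm]
      exact sum_congr rfl fun i _ => sum_congr rfl fun j _ => by rw [hsymm]
    have e3 : ∑ i ∈ range n, ∑ j ∈ range n, d i j * (β j / β i - 1) +
        ∑ i ∈ range n, ∑ j ∈ range n, d i j * (β i / β j - 1) =
        ∑ i ∈ range n, ∑ j ∈ range n, d i j * φ i j +
        ∑ i ∈ range n, ∑ j ∈ range n, d i j * φ j i := by
      simp_rw [← sum_add_distrib]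
      refine sum_congr rfl fun i hi => sum_congr rfl fun j hj => ?_
      have hi := mem_range.1 hi
      have hj := mem_range.1 hj
      have hc : g i j = g j i := by simp only [hg]; ring
      have : φ i j + φ j i = g i j := by
        rcases le_total i j with h | h
        · rw [hφ0 j i h, hφle i j hi h, add_zero]
        · rw [hφ0 i j h, hφle j i hj h, zero_add, hc]
      rw [← mul_add, ← mul_add, this]
      simp only [hg]; ring
    linarith
  rw [hfold]
  have hrhs : ∑ l ∈ range p, (if l ≤ n - 1 - l then
        β l / β (n - 1 - l) + β (n - 1 - l) / β l - 2 else 0) =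
      ∑ l ∈ range p, φ l (n - 1 - l) := by
    refine sum_congr rfl fun l hl => ?_
    have := mem_range.1 hl
    split_ifs with h
    · exact (hφle l _ (by omega) h).symm
    · exact (hφ0 _ _ (by omega)).symm
  rw [hrhs]
  -- The cut-off loses nothing, since `b < j < n` forces `b + 1 < n`; it keeps every index in the
  -- range where `β` is controlled.
  set Δ : ℕ → ℕ → ℝ := fun a b => if b + 1 < n then
    φ a (b + 1) - φ a b - φ (a + 1) (b + 1) + φ (a + 1) b else 0 with hΔ
  have hΔ0 : ∀ a b, b < a → Δ a b = 0 := by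
    intro a b h
    simp only [hΔ]
    rw [hφ0 a (b + 1) (by omega), hφ0 a b (by omega), hφ0 (a + 1) (b + 1) (by omega),
      hφ0 (a + 1) b (by omega)]
    simp
  refine sum_mul_le_sum_antidiagonal_of_quadrants hp φ Δ d ?_ ?_ ?_
  · intro i hi j hj
    rw [eq_sum_mixed_difference φ hφ0 hi hj]
    refine sum_congr rfl fun a _ => sum_congr rfl fun b _ => ?_
    split_ifs with h
    · simp only [hΔ]; rw [if_pos (by omega)]
    · rfl
  · intro a ha b hb
    rcases lt_or_ge b a with h | h
    · exact (hΔ0 a b h).ge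
    simp only [hΔ]
    split_ifs with hbn
    swap
    · exact le_rfl
    rcases h.eq_or_lt with rfl | h
    · rw [hφ0 a a le_rfl, hφ0 (a + 1) (a + 1) le_rfl, hφ0 (a + 1) a (by omega),
        hφle a (a + 1) ha (by omega)]
      simpa using hgnn a ha (a + 1) hbn
    · rw [hφle a (b + 1) ha (by omega), hφle a b ha (by omega),
        hφle (a + 1) (b + 1) (by omega) (by omega), hφle (a + 1) b (by omega) (by omega)]
      -- Strictly above the diagonal the mixed difference of `g` is exactly the sum of these two
      -- products.
      have k1 : (β a - β (a + 1)) * ((β (b + 1))⁻¹ - (β b)⁻¹) ≥ 0 := by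
        refine mul_nonneg (sub_nonneg.2 (hanti _ _ (by omega) (by omega))) (sub_nonneg.2 ?_)
        exact inv_anti₀ (hpos _ hbn) (hanti _ _ (by omega) hbn)
      have k2 : (β b - β (b + 1)) * ((β (a + 1))⁻¹ - (β a)⁻¹) ≥ 0 := by
        refine mul_nonneg (sub_nonneg.2 (hanti _ _ (by omega) hbn)) (sub_nonneg.2 ?_)
        exact inv_anti₀ (hpos _ (by omega)) (hanti _ _ (by omega) (by omega))
      simp only [hg, div_eq_mul_inv]
      linarith
  · intro a ha b hb hab
    have hab : a ≤ b := by
      by_contra h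
      exact hab (hΔ0 a b (by omega))
    have hcount : (∑ l ∈ range p, if l ≤ a ∧ b < n - 1 - l then (1 : ℝ) else 0) =
        (min p (min (a + 1) (n - 1 - b)) : ℕ) := by
      rw [← sum_filter, sum_const, nsmul_eq_mul, mul_one]
      have : (range p).filter (fun l => l ≤ a ∧ b < n - 1 - l) =
          range (min p (min (a + 1) (n - 1 - b))) := by
        ext l; simp only [mem_filter, mem_range]; omega
      rw [this, card_range]
    rw [hcount, Nat.cast_min, Nat.cast_min]
    have hite : ∀ (q : Prop) [Decidable q] (x : ℝ), 0 ≤ x → (if q then x else 0) ≤ x := by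
      intro q _ x hx; split_ifs
      · exact le_rfl
      · exact hx
    have hrowsum : ∀ (q : ℕ → Prop) [DecidablePred q], (∑ i ∈ range n, if q i then
        ∑ j ∈ range n, d i j else 0) ≤ ((range n).filter q).card := by
      intro q _
      rw [← sum_filter, card_eq_sum_ones, Nat.cast_sum, Nat.cast_one]
      exact sum_le_sum fun i hi => hrow i (mem_range.1 (mem_filter.1 hi).1)
    -- Bound by `p`: since `a ≤ b`, the quadrant and its transpose are disjoint and of equal mass,
    -- so each has at most half of `2p`. The other bounds count the rows and the columns that the
    -- quadrant meets.
    refine le_min ?_ (le_min ?_ ?_)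
    · have e : (∑ i ∈ range n, ∑ j ∈ range n, if i ≤ a ∧ b < j then d i j else 0) =
          ∑ i ∈ range n, ∑ j ∈ range n, if j ≤ a ∧ b < i then d i j else 0 := by
        rw [sum_comm]
        exact sum_congr rfl fun i _ => sum_congr rfl fun j _ => by rw [hsymm]
      have : (∑ i ∈ range n, ∑ j ∈ range n, if i ≤ a ∧ b < j then d i j else 0) +
          (∑ i ∈ range n, ∑ j ∈ range n, if j ≤ a ∧ b < i then d i j else 0) ≤
          ∑ i ∈ range n, ∑ j ∈ range n, d i j := by
        simp_rw [← sum_add_distrib]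
        refine sum_le_sum fun i _ => sum_le_sum fun j _ => ?_
        have := hd i j
        split_ifs <;> first | (exfalso; omega) | linarith
      linarith
    · calc _ ≤ ∑ i ∈ range n, if i ≤ a then ∑ j ∈ range n, d i j else 0 := by
            refine sum_le_sum fun i _ => ?_
            split_ifs with h
            · exact sum_le_sum fun j _ => hite _ _ (hd i j)
            · simp [h]
        _ ≤ _ := hrowsum _
        _ ≤ _ := by
            have : (range n).filter (fun i => i ≤ a) ⊆ range (a + 1) := by
              intro i; simp only [mem_filter, mem_range]; omega
            have := card_le_card this
            rw [card_range] at this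
            exact_mod_cast this
    · calc _ = ∑ j ∈ range n, ∑ i ∈ range n, if i ≤ a ∧ b < j then d i j else 0 := sum_comm
        _ ≤ ∑ j ∈ range n, if b < j then ∑ i ∈ range n, d j i else 0 := by
            refine sum_le_sum fun j _ => ?_
            split_ifs with h
            · refine sum_le_sum fun i _ => ?_
              rw [hsymm j i]
              exact hite _ _ (hd i j)
            · simp [h]
        _ ≤ _ := hrowsum _
        _ ≤ _ := by
            have : (range n).filter (fun j => b < j) ⊆ Ico (b + 1) n := by
              intro i; simp only [mem_filter, mem_range, mem_Ico]; omega
            have := card_le_card this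
            rw [Nat.card_Ico, show n - (b + 1) = n - 1 - b by omega] at this
            exact_mod_cast this

/-! ### Substochastic weights from a selfadjoint projection -/

section
variable {F : Type*} [NormedAddCommGroup F] [InnerProductSpace ℝ F]

open scoped InnerProductSpace

theorem sum_inner_sq_eq_one {ι : Type*} [Fintype ι] (b : OrthonormalBasis ι ℝ F) {x : F}
    (hx : ‖x‖ = 1) : ∑ i, ⟪b i, x⟫_ℝ ^ 2 = 1 := by
  have := b.sum_sq_norm_inner_right x
  simpa [hx] using this

theorem inner_apply_self_eq_sum {ι : Type*} [Fintype ι] (b : OrthonormalBasis ι ℝ F)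
    {A : F →ₗ[ℝ] F} (hA : A.IsSymmetric) {α : ι → ℝ} (hb : ∀ i, A (b i) = α i • b i) (x : F) :
    ⟪A x, x⟫_ℝ = ∑ i, α i * ⟪b i, x⟫_ℝ ^ 2 := by
  rw [← b.sum_inner_mul_inner (A x) x]
  refine sum_congr rfl fun i _ => ?_
  rw [hA, hb, inner_smul_right, real_inner_comm]
  ring

/-- Weights built from a biorthogonal kernel: if `κ` is symmetrizable by `γ` and squares to the
identity, its entries `κ s t * κ t s` spread along the isometry `f` form a doubly substochastic
matrix whose sum of ratios `α j / α i` dominates the Frobenius norm of `κ`. -/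
theorem exists_substochastic_of_symmetrizable {ι σ : Type*} [Fintype ι] [Fintype σ]
    [DecidableEq ι] [DecidableEq σ] (o : ι) (α : ι → ℝ) (hα : ∀ i ≠ o, 0 < α i) (f : ι → σ → ℝ)
    (fo : ∀ s, f o s = 0) (fcol : ∀ s, ∑ i, f i s ^ 2 = 1) (frow : ∀ i, ∑ s, f i s ^ 2 ≤ 1)
    (γ : σ → ℝ) (hγ : ∀ s, γ s = ∑ i, α i * f i s ^ 2)
    (κ : σ → σ → ℝ) (hsym : ∀ s t, γ s * κ s t = γ t * κ t s)
    (hsq : ∀ s, ∑ t, κ s t * κ t s = 1) :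
    ∃ d : ι → ι → ℝ, (∀ i j, 0 ≤ d i j) ∧ (∀ i j, d i j = d j i) ∧ (∀ j, d o j = 0) ∧
      (∀ i, ∑ j, d i j ≤ 1) ∧ (∑ i, ∑ j, d i j = Fintype.card σ) ∧
      ∑ s, ∑ t, κ s t ^ 2 ≤ ∑ i, ∑ j, d i j * (α j / α i) := by
  have γpos : ∀ s, 0 < γ s := by
    intro s
    have hne : ∃ i ∈ (univ : Finset ι), f i s ^ 2 ≠ 0 :=
      exists_ne_zero_of_sum_ne_zero (by rw [fcol]; exact one_ne_zero)
    obtain ⟨i, -, hi⟩ := hne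
    rw [hγ]
    refine sum_pos' (fun j _ => ?_) ⟨i, mem_univ _, ?_⟩
    · by_cases hj : j = o
      · simp [hj, fo]
      · exact mul_nonneg (hα j hj).le (sq_nonneg _)
    · have : i ≠ o := by rintro rfl; simp [fo] at hi
      exact mul_pos (hα i this) (lt_of_le_of_ne (sq_nonneg _) hi.symm)
  -- Jensen for `1/x`: its tangent at `γ s`, `2 / γ s - x / γ s ^ 2`, lies below it; average over
  -- the weights `f i s ^ 2`.
  have hinv : ∀ s, 1 / γ s ≤ ∑ i, f i s ^ 2 / α i := by
    intro s
    have h := γpos s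
    have : 1 / γ s = ∑ i, f i s ^ 2 * (2 / γ s - α i / γ s ^ 2) := by
      calc 1 / γ s = (∑ i, f i s ^ 2) * (2 / γ s) - (∑ i, α i * f i s ^ 2) / γ s ^ 2 := by
            rw [fcol, ← hγ]; field_simp; norm_num
        _ = _ := by
            rw [sum_mul, sum_div, ← sum_sub_distrib]
            exact sum_congr rfl fun i _ => by ring
    rw [this]
    refine sum_le_sum fun i _ => ?_
    by_cases hi : i = o
    · simp [hi, fo]
    rw [div_eq_mul_inv (f i s ^ 2)]
    refine mul_le_mul_of_nonneg_left ?_ (sq_nonneg _)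
    have hi := hα i hi
    have : (α i)⁻¹ - (2 / γ s - α i / γ s ^ 2) = (γ s - α i) ^ 2 / (α i * γ s ^ 2) := by
      field_simp; ring
    have : 0 ≤ (α i)⁻¹ - (2 / γ s - α i / γ s ^ 2) := by rw [this]; positivity
    linarith
  have hδ : ∀ s t, 0 ≤ κ s t * κ t s := by
    intro s t
    have : κ s t = γ t * κ t s / γ s := by
      rw [eq_div_iff (γpos s).ne', mul_comm, hsym]
    rw [this]
    have := γpos s; have := γpos t
    have e : γ t * κ t s / γ s * κ t s = γ t / γ s * κ t s ^ 2 := by ring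
    rw [e]; positivity
  -- The symmetric stochastic matrix `κ s t * κ t s`, spread over the eigenvalues of the large space
  -- by the squared coordinates of the small basis.
  refine ⟨fun i j => ∑ s, ∑ t, κ s t * κ t s * (f i s ^ 2 * f j t ^ 2), ?_, ?_, ?_, ?_, ?_, ?_⟩
  · exact fun i j => sum_nonneg fun s _ => sum_nonneg fun t _ =>
      mul_nonneg (hδ s t) (by positivity)
  · intro i j
    beta_reduce
    rw [sum_comm]
    exact sum_congr rfl fun s _ => sum_congr rfl fun t _ => by ring
  · intro j; simp [fo]
  · intro i
    have : ∑ j, ∑ s, ∑ t, κ s t * κ t s * (f i s ^ 2 * f j t ^ 2) = ∑ s, f i s ^ 2 := by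
      rw [sum_comm]
      refine sum_congr rfl fun s _ => ?_
      rw [sum_comm]
      calc _ = ∑ t, κ s t * κ t s * f i s ^ 2 := by
            refine sum_congr rfl fun t _ => ?_
            simp_rw [← mul_assoc]
            rw [← mul_sum, fcol, mul_one]
        _ = _ := by rw [← sum_mul, hsq, one_mul]
    rw [this]; exact frow i
  · have : ∀ i, ∑ j, ∑ s, ∑ t, κ s t * κ t s * (f i s ^ 2 * f j t ^ 2) = ∑ s, f i s ^ 2 := by
      intro i
      rw [sum_comm]
      refine sum_congr rfl fun s _ => ?_
      rw [sum_comm]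
      calc _ = ∑ t, κ s t * κ t s * f i s ^ 2 := by
            refine sum_congr rfl fun t _ => ?_
            simp_rw [← mul_assoc]
            rw [← mul_sum, fcol, mul_one]
        _ = _ := by rw [← sum_mul, hsq, one_mul]
    simp_rw [this]
    rw [sum_comm]
    simp [fcol]
  · calc ∑ s, ∑ t, κ s t ^ 2 = ∑ s, ∑ t, κ s t * κ t s * (γ t * (1 / γ s)) := by
          refine sum_congr rfl fun s _ => sum_congr rfl fun t _ => ?_
          have h := (γpos s).ne'
          have e : κ s t * κ t s * (γ t * (1 / γ s)) = κ s t * (γ t * κ t s) / γ s := by ring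
          rw [e, ← hsym]; field_simp
      _ ≤ ∑ s, ∑ t, κ s t * κ t s * ((∑ j, α j * f j t ^ 2) * ∑ i, f i s ^ 2 / α i) := by
          refine sum_le_sum fun s _ => sum_le_sum fun t _ =>
            mul_le_mul_of_nonneg_left ?_ (hδ s t)
          rw [← hγ]
          exact mul_le_mul_of_nonneg_left (hinv s) (γpos t).le
      _ = ∑ s, ∑ t, ∑ i, ∑ j, κ s t * κ t s * (f i s ^ 2 * f j t ^ 2) * (α j / α i) := by
          refine sum_congr rfl fun s _ => sum_congr rfl fun t _ => ?_
          rw [mul_comm (∑ j, _), sum_mul_sum, mul_sum]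
          refine sum_congr rfl fun i _ => ?_
          rw [mul_sum]
          exact sum_congr rfl fun j _ => by ring
      _ = ∑ s, ∑ i, ∑ j, ∑ t, κ s t * κ t s * (f i s ^ 2 * f j t ^ 2) * (α j / α i) := by
          refine sum_congr rfl fun s _ => ?_
          rw [sum_comm]
          exact sum_congr rfl fun i _ => sum_comm
      _ = _ := by
          rw [sum_comm]
          refine sum_congr rfl fun i _ => ?_
          rw [sum_comm]
          refine sum_congr rfl fun j _ => ?_
          simp_rw [sum_mul]

variable [FiniteDimensional ℝ F]

/-- The Frobenius norm of an `A`-selfadjoint projection `P` is controlled by a symmetric doubly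
substochastic combination of the ratios of eigenvalues of `A`, of total weight at most
`2 * rank P`. -/
theorem exists_substochastic_of_projection {ι : Type*} [Fintype ι] [DecidableEq ι]
    (b : OrthonormalBasis ι ℝ F) {A : F →ₗ[ℝ] F} (hA : A.IsSymmetric) {α : ι → ℝ}
    (hb : ∀ i, A (b i) = α i • b i) (o : ι) (hα : ∀ i ≠ o, 0 < α i) {P : F →ₗ[ℝ] F}
    (hP : ∀ x, P (P x) = P x) (hAP : ∀ x y, ⟪A (P x), y⟫_ℝ = ⟪A x, P y⟫_ℝ)
    (ho : P (b o) = 0) (ho' : ∀ x, ⟪b o, P x⟫_ℝ = 0) :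
    ∃ d : ι → ι → ℝ, (∀ i j, 0 ≤ d i j) ∧ (∀ i j, d i j = d j i) ∧ (∀ j, d o j = 0) ∧
      (∀ i, ∑ j, d i j ≤ 1) ∧
      (∑ i, ∑ j, d i j ≤ 2 * Module.finrank ℝ (LinearMap.range P)) ∧
      4 * ∑ i, ‖P (b i)‖ ^ 2 - 4 * ∑ i, ⟪b i, P (b i)⟫_ℝ ≤
        ∑ i, ∑ j, d i j * (α j / α i - 1) := by
  -- Containing `range P` makes `W` stable under `2P - 1`; containing the range of the adjoint makes
  -- the Frobenius norm and trace of `P` computable on `W` alone.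
  set W : Submodule ℝ F := LinearMap.range P ⊔ LinearMap.range P.adjoint with hW
  have hPW : ∀ x, P x ∈ W := fun x => Submodule.mem_sup_left ⟨x, rfl⟩
  have hPaW : ∀ x, P.adjoint x ∈ W := fun x => Submodule.mem_sup_right ⟨x, rfl⟩
  have hcard : Module.finrank ℝ W ≤ 2 * Module.finrank ℝ (LinearMap.range P) := by
    have := Submodule.finrank_add_le_finrank_add_finrank (LinearMap.range P)
      (LinearMap.range P.adjoint)
    rw [LinearMap.finrank_range_adjoint, ← hW] at this
    omega
  have hoW : ∀ w ∈ W, ⟪b o, w⟫_ℝ = 0 := by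
    intro w hw
    obtain ⟨_, ⟨x, rfl⟩, _, ⟨y, rfl⟩, rfl⟩ := Submodule.mem_sup.1 hw
    rw [inner_add_right, ho', LinearMap.adjoint_inner_right, ho, inner_zero_left, add_zero]
  set C : W →ₗ[ℝ] W :=
    (W.orthogonalProjectionOnto : F →ₗ[ℝ] W) ∘ₗ A ∘ₗ W.subtype with hC
  have hCi : ∀ x y : W, ⟪C x, y⟫_ℝ = ⟪A x, (y : F)⟫_ℝ := by
    intro x y
    rw [Submodule.coe_inner]
    exact Submodule.inner_orthogonalProjectionOnto_eq_of_mem_right y (A x)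
  have hCs : C.IsSymmetric := by
    intro x y
    rw [hCi, real_inner_comm (C y), hCi, hA, real_inner_comm]
  set e := hCs.eigenvectorBasis rfl with he
  set γ := hCs.eigenvalues rfl with hγ
  have hCe : ∀ s, C (e s) = γ s • e s := fun s => hCs.apply_eigenvectorBasis rfl s
  have hAe : ∀ s, ∀ w ∈ W, ⟪A (e s), w⟫_ℝ = γ s * ⟪(e s : F), w⟫_ℝ := by
    intro s w hw
    rw [← hCi (e s) ⟨w, hw⟩, hCe, inner_smul_left, Submodule.coe_inner]
    simp
  have hexp : ∀ w ∈ W, ∑ s, ⟪(e s : F), w⟫_ℝ • (e s : F) = w := by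
    intro w hw
    have := congrArg (W.subtype) (e.sum_repr' ⟨w, hw⟩)
    simpa using this
  have hpars : ∀ x ∈ W, ∀ y, ∑ s, ⟪x, (e s : F)⟫_ℝ * ⟪(e s : F), y⟫_ℝ = ⟪x, y⟫_ℝ := by
    intro x hx y
    conv_rhs => rw [← hexp x hx, sum_inner]
    refine sum_congr rfl fun s _ => ?_
    rw [inner_smul_left, real_inner_comm]; simp
  have hnorm : ∀ s, ‖(e s : F)‖ = 1 := fun s => e.orthonormal.1 s
  have hmem : ∀ s, (e s : F) ∈ W := fun s => (e s).2
  have horth : Orthonormal ℝ (fun s => (e s : F)) := by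
    have := e.orthonormal.comp_linearIsometry W.subtypeₗᵢ
    exact this
  -- The reflection squares to the identity, so the products `κ s t * κ t s` have row sums exactly
  -- `1`.
  set K : F →ₗ[ℝ] F := (2 : ℝ) • P - LinearMap.id with hK
  have hKx : ∀ x, K x = (2 : ℝ) • P x - x := fun x => by simp [hK]
  have hKW : ∀ x ∈ W, K x ∈ W := fun x hx => by
    rw [hKx]; exact W.sub_mem (W.smul_mem _ (hPW x)) hx
  have hKK : ∀ x, K (K x) = x := fun x => by
    rw [hKx, hKx, map_sub, map_smul, hP]; module
  have hAK : ∀ x y, ⟪A (K x), y⟫_ℝ = ⟪A x, K y⟫_ℝ := fun x y => by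
    rw [hKx, hKx, map_sub, map_smul, inner_sub_left, inner_sub_right, inner_smul_left,
      inner_smul_right, hAP]; simp
  obtain ⟨d, d0, ds, dO, drow, dtot, dle⟩ := exists_substochastic_of_symmetrizable o α hα
    (fun i s => ⟪b i, (e s : F)⟫_ℝ) (fun s => hoW _ (hmem s))
    (fun s => sum_inner_sq_eq_one b (hnorm s))
    (fun i => by
      have := horth.sum_inner_products_le (b i) (s := univ)
      simpa [real_inner_comm, b.orthonormal.1 i] using this)
    γ (fun s => by
      rw [← inner_apply_self_eq_sum b hA hb, hAe s _ (hmem s)]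
      simp [hnorm])
    (fun s t => ⟪(e s : F), K (e t)⟫_ℝ)
    (fun s t => by
      rw [← hAe s _ (hKW _ (hmem t)), ← hAe t _ (hKW _ (hmem s)), ← hAK, hA, real_inner_comm])
    (fun s => by
      have h1 : ⟪(e s : F), K (∑ t, ⟪(e t : F), K (e s)⟫_ℝ • (e t : F))⟫_ℝ = 1 := by
        rw [hexp _ (hKW _ (hmem s)), hKK]; simp [hnorm]
      rw [map_sum, inner_sum] at h1
      rw [← h1]
      refine sum_congr rfl fun t _ => ?_
      rw [map_smul, inner_smul_right, mul_comm])
  refine ⟨d, d0, ds, dO, drow, ?_, ?_⟩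
  · rw [dtot, Fintype.card_fin]; exact_mod_cast hcard
  -- Transposed, both sides sum squared coordinates of `P.adjoint (b j)`, which lies in `W`, where
  -- the `e t` form a basis.
  have hfrob : ∑ t, ‖P (e t)‖ ^ 2 = ∑ i, ‖P (b i)‖ ^ 2 := by
    have h1 : ∀ i, ‖P (b i)‖ ^ 2 = ∑ j, ⟪b j, P (b i)⟫_ℝ ^ 2 := fun i => by
      simpa using (b.sum_sq_norm_inner_right (P (b i))).symm
    have h2 : ∀ t, ‖P (e t)‖ ^ 2 = ∑ j, ⟪b j, P (e t)⟫_ℝ ^ 2 := fun t => by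
      simpa using (b.sum_sq_norm_inner_right (P (e t))).symm
    simp_rw [h1, h2]
    rw [sum_comm]
    conv_rhs => rw [sum_comm]
    refine sum_congr rfl fun j _ => ?_
    simp_rw [← LinearMap.adjoint_inner_left, sq]
    have h3 := hpars _ (hPaW (b j)) (P.adjoint (b j))
    have h4 := b.sum_inner_mul_inner (P.adjoint (b j)) (P.adjoint (b j))
    rw [← h3] at h4
    rw [← sum_congr rfl fun s _ => ?_, ← h4, sum_congr rfl fun s _ => ?_]
    · rw [real_inner_comm (b s)]
    · rw [real_inner_comm (e s : F)]
  have htr : ∑ t, ⟪(e t : F), P (e t)⟫_ℝ = ∑ i, ⟪b i, P (b i)⟫_ℝ := by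
    have h1 : ∀ t, ⟪(e t : F), P (e t)⟫_ℝ =
        ∑ i, ⟪P.adjoint (b i), (e t : F)⟫_ℝ * ⟪(e t : F), b i⟫_ℝ := by
      intro t
      rw [← b.sum_inner_mul_inner]
      refine sum_congr rfl fun i _ => ?_
      rw [LinearMap.adjoint_inner_left, mul_comm]
    simp_rw [h1]
    rw [sum_comm]
    refine sum_congr rfl fun i _ => ?_
    rw [hpars _ (hPaW _), LinearMap.adjoint_inner_left]
  have hKsum : ∑ s, ∑ t, ⟪(e s : F), K (e t)⟫_ℝ ^ 2 =
      4 * ∑ i, ‖P (b i)‖ ^ 2 - 4 * ∑ i, ⟪b i, P (b i)⟫_ℝ + Module.finrank ℝ W := by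
    rw [sum_comm, ← hfrob, ← htr]
    have h1 : ∀ t, ∑ s, ⟪(e s : F), K (e t)⟫_ℝ ^ 2 =
        4 * ‖P (e t)‖ ^ 2 - 4 * ⟪(e t : F), P (e t)⟫_ℝ + 1 := by
      intro t
      have h := hpars _ (hKW _ (hmem t)) (K (e t))
      rw [real_inner_self_eq_norm_sq, hKx, norm_sub_sq_real, hnorm, norm_smul,
        inner_smul_left, ← hKx] at h
      rw [real_inner_comm (P _)]
      have : ∑ s, ⟪(e s : F), K (e t)⟫_ℝ ^ 2 =
          ∑ s, ⟪K (e t), (e s : F)⟫_ℝ * ⟪(e s : F), K (e t)⟫_ℝ :=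
        sum_congr rfl fun s _ => by rw [real_inner_comm, sq]
      rw [this, h, mul_pow]
      simp only [Real.norm_ofNat, conj_trivial]
      ring
    simp_rw [h1]
    rw [sum_add_distrib, sum_sub_distrib, mul_sum, mul_sum]
    simp
  have : ∑ i, ∑ j, d i j * (α j / α i - 1) =
      ∑ i, ∑ j, d i j * (α j / α i) - Module.finrank ℝ W := by
    rw [← Fintype.card_fin (Module.finrank ℝ W), ← dtot, ← sum_sub_distrib]
    refine sum_congr rfl fun i _ => ?_
    rw [← sum_sub_distrib]
    exact sum_congr rfl fun j _ => by ring
  linarith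
end

/-! ### Harmonic extension and regularised reconstruction -/

section
variable {F : Type*} [NormedAddCommGroup F] [InnerProductSpace ℝ F]

open scoped InnerProductSpace

/-- Kantorovich's quadratic inequality `‖A x‖² + l h ‖x‖² ≤ (l + h) ⟪A x, x⟫` for a vector in the
span of the eigenvectors with eigenvalues in `[l, h]`. -/
theorem norm_sq_add_le_mul_inner {ι : Type*} [Fintype ι] (b : OrthonormalBasis ι ℝ F)
    {A : F →ₗ[ℝ] F} (hA : A.IsSymmetric) {α : ι → ℝ} (hb : ∀ i, A (b i) = α i • b i) {o : ι}
    {l h : ℝ} (hl : ∀ i ≠ o, l ≤ α i) (hh : ∀ i ≠ o, α i ≤ h) {x : F} (hx : ⟪b o, x⟫_ℝ = 0) :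
    ‖A x‖ ^ 2 + l * h * ‖x‖ ^ 2 ≤ (l + h) * ⟪A x, x⟫_ℝ := by
  have h1 : ‖A x‖ ^ 2 = ∑ i, α i ^ 2 * ⟪b i, x⟫_ℝ ^ 2 := by
    have := b.sum_sq_norm_inner_right (A x)
    rw [← this]
    refine sum_congr rfl fun i _ => ?_
    rw [← hA, hb, inner_smul_left, ← mul_pow]
    simp only [conj_trivial, Real.norm_eq_abs, sq_abs]
  have h2 : ‖x‖ ^ 2 = ∑ i, ⟪b i, x⟫_ℝ ^ 2 := by
    simpa using (b.sum_sq_norm_inner_right x).symm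
  rw [h1, h2, inner_apply_self_eq_sum b hA hb, mul_sum, mul_sum, ← sum_add_distrib]
  refine sum_le_sum fun i _ => ?_
  by_cases hi : i = o
  · simp [hi, hx]
  have := mul_nonneg (mul_nonneg (sub_nonneg.2 (hl i hi)) (sub_nonneg.2 (hh i hi)))
    (sq_nonneg ⟪b i, x⟫_ℝ)
  linarith

theorem inner_apply_self_nonneg_of_eigenvalues {ι : Type*} [Fintype ι]
    (b : OrthonormalBasis ι ℝ F) {A : F →ₗ[ℝ] F} (hA : A.IsSymmetric) {α : ι → ℝ}
    (hb : ∀ i, A (b i) = α i • b i) (hα : ∀ i, 0 ≤ α i) (x : F) : 0 ≤ ⟪A x, x⟫_ℝ := by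
  rw [inner_apply_self_eq_sum b hA hb]
  exact sum_nonneg fun i _ => mul_nonneg (hα i) (sq_nonneg _)

/-- A positive semidefinite operator whose kernel is spanned by `u` is definite on the kernel of
any linear map not vanishing at `u`. -/
theorem eq_zero_of_inner_apply_self_eq_zero {ι : Type*} [Fintype ι]
    (b : OrthonormalBasis ι ℝ F) {A E : F →ₗ[ℝ] F} (hA : A.IsSymmetric) {α : ι → ℝ}
    (hb : ∀ i, A (b i) = α i • b i) {o : ι} (hαo : α o = 0) (hα : ∀ i ≠ o, 0 < α i)
    {u : F} {c : ℝ} (hc : c ≠ 0) (hu : u = c • b o) (hEu : E u ≠ 0) {x : F}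
    (hx : ⟪A x, x⟫_ℝ = 0) (hEx : E x = 0) : x = 0 := by
  have hα' : ∀ i, 0 ≤ α i := fun i => by
    by_cases hi : i = o
    · rw [hi, hαo]
    · exact (hα i hi).le
  rw [inner_apply_self_eq_sum b hA hb,
    sum_eq_zero_iff_of_nonneg fun i _ => mul_nonneg (hα' i) (sq_nonneg _)] at hx
  have h1 : x = ⟪b o, x⟫_ℝ • b o := by
    classical
    conv_lhs => rw [← b.sum_repr' x]
    refine sum_eq_single o (fun i _ hi => ?_) (by simp)
    have := (mul_eq_zero.1 (hx i (mem_univ _))).resolve_left (hα i hi).ne'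
    rw [pow_eq_zero_iff two_ne_zero] at this
    rw [this, zero_smul]
  have hbo : b o = c⁻¹ • u := by rw [hu, smul_smul, inv_mul_cancel₀ hc, one_smul]
  rw [h1, hbo, map_smul, map_smul, smul_eq_zero, smul_eq_zero] at hEx
  rcases hEx with h2 | h2 | h2
  · rw [← hbo] at h2; rw [h1, h2, zero_smul]
  · exact absurd h2 (inv_ne_zero hc)
  · exact absurd h2 hEu

variable [FiniteDimensional ℝ F]

theorem sum_norm_sq_apply_eq_adjoint {ι κ : Type*} [Fintype ι] [Fintype κ]
    (b : OrthonormalBasis ι ℝ F) (c : OrthonormalBasis κ ℝ F) (T : F →ₗ[ℝ] F) :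
    ∑ i, ‖T (b i)‖ ^ 2 = ∑ j, ‖T.adjoint (c j)‖ ^ 2 := by
  have h1 : ∀ i, ‖T (b i)‖ ^ 2 = ∑ j, ⟪c j, T (b i)⟫_ℝ ^ 2 := fun i => by
    simpa using (c.sum_sq_norm_inner_right (T (b i))).symm
  have h2 : ∀ j, ‖T.adjoint (c j)‖ ^ 2 = ∑ i, ⟪c j, T (b i)⟫_ℝ ^ 2 := fun j => by
    have := b.sum_sq_norm_inner_left (T.adjoint (c j))
    simp_rw [LinearMap.adjoint_inner_left] at this
    simpa using this.symm
  simp_rw [h1, h2]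
  exact sum_comm

/-- The harmonic extension operator: `H x` agrees with `x` on the range of the projection `E` and
is `A`-harmonic off it. -/
theorem exists_harmonic_extension {A E : F →ₗ[ℝ] F} (hE : E.IsSymmetric) (hEE : ∀ x, E (E x) = E x)
    (hdef : ∀ x, ⟪A x, x⟫_ℝ = 0 → E x = 0 → x = 0) :
    ∃ H : F →ₗ[ℝ] F, (∀ x, E (H x) = E x) ∧ (∀ x, H (E x) = H x) ∧
      (∀ x, E (A (H x)) = A (H x)) ∧ ∀ x, E (A x) = A x → H x = x := by
  -- `M = E + (1 - E) A` encodes the Dirichlet problem: values on the range of `E`, harmonicity off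
  -- it. Thus `H = M⁻¹ E`.
  set M : F →ₗ[ℝ] F := E + A - E ∘ₗ A with hM
  have hMx : ∀ x, M x = E x + A x - E (A x) := fun x => rfl
  have hEM : ∀ x, E (M x) = E x := fun x => by
    rw [hMx, map_sub, map_add, hEE, hEE]; abel
  have hinj : Function.Injective M := by
    rw [injective_iff_map_eq_zero]
    intro x hx
    have h1 : E x = 0 := by rw [← hEM, hx, map_zero]
    refine hdef x ?_ h1
    rw [hMx, h1, zero_add, sub_eq_zero] at hx
    rw [hx, hE, h1, inner_zero_right]
  set e := LinearEquiv.ofInjectiveEndo M hinj with he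
  have heM : ∀ x, e x = M x := fun x => rfl
  have hEe : ∀ x, E (e.symm x) = E x := fun x => by
    rw [← hEM (e.symm x), ← heM, e.apply_symm_apply]
  refine ⟨e.symm.toLinearMap ∘ₗ E, ?_, ?_, ?_, ?_⟩
  · intro x
    change E (e.symm (E x)) = _
    rw [hEe, hEE]
  · intro x
    change e.symm (E (E x)) = e.symm (E x)
    rw [hEE]
  · intro x
    change E (A (e.symm (E x))) = A (e.symm (E x))
    have h1 := heM (e.symm (E x))
    rw [e.apply_symm_apply, hMx, hEe, hEE, add_sub_assoc, left_eq_add, sub_eq_zero] at h1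
    exact h1.symm
  · intro x hx
    change e.symm (E x) = x
    rw [LinearEquiv.symm_apply_eq, heM, hMx, hx]; abel

/-- Regularised reconstruction has a smaller Frobenius norm than harmonic extension. -/
theorem sum_norm_sq_reconstruction_le {ι : Type*} [Fintype ι] (c : OrthonormalBasis ι ℝ F)
    {A E B H : F →ₗ[ℝ] F} {μ : ℝ} (hμ : 0 < μ) (hA : A.IsSymmetric) (hApos : ∀ x, 0 ≤ ⟪A x, x⟫_ℝ)
    (hE : E.IsSymmetric) (hEE : ∀ x, E (E x) = E x) (hB : ∀ x, E (B x) + μ • A (B x) = x)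
    (hHE : ∀ x, H (E x) = H x) (hH : ∀ x, E (A x) = A x → H x = x) :
    ∑ i, ‖B (E (c i))‖ ^ 2 ≤ ∑ i, ‖H (c i)‖ ^ 2 := by
  set X : F →ₗ[ℝ] F := E ∘ₗ B ∘ₗ E with hX
  have hBs : B.IsSymmetric := by
    intro x y
    conv_lhs => rw [← hB y]
    conv_rhs => rw [← hB x]
    rw [inner_add_right, inner_add_left, inner_smul_right, inner_smul_left, hE, hA]; rfl
  have hXs : X.IsSymmetric := by
    intro x y
    change ⟪E (B (E x)), y⟫_ℝ = ⟪x, E (B (E y))⟫_ℝ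
    rw [hE, hBs, hE]
  have hXle : ∀ x, ‖X x‖ ≤ ‖x‖ := by
    intro x
    set y := B (E x) with hy
    change ‖E y‖ ≤ ‖x‖
    -- Energy identity: the equation `E y + μ A y = E x` tested against `y`.
    have h1 : ⟪y, E x⟫_ℝ = ‖E y‖ ^ 2 + μ * ⟪A y, y⟫_ℝ := by
      conv_lhs => rw [← hB (E x), ← hy]
      rw [inner_add_right, inner_smul_right, real_inner_comm (A y), ← real_inner_self_eq_norm_sq,
        hE, hEE]
    have h2 : ⟪y, E x⟫_ℝ ≤ ‖E y‖ * ‖x‖ := by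
      rw [← hE]; exact real_inner_le_norm _ _
    have h3 := mul_nonneg hμ.le (hApos y)
    rcases (norm_nonneg (E y)).eq_or_lt with h | h
    · rw [← h]; exact norm_nonneg _
    · nlinarith
  have hBE : ∀ x, B (E x) = (H ∘ₗ X) x := by
    intro x
    set y := B (E x) with hy
    change y = H (E y)
    have h1 := hB (E x)
    rw [← hy] at h1
    have h2 : E (E y + μ • A y) = E y + μ • A y := by rw [h1, hEE]
    rw [map_add, hEE, map_smul, add_right_inj] at h2
    rw [hHE, hH y (smul_right_injective F hμ.ne' h2)]
  simp_rw [hBE]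
  have hXa : X.adjoint = X := (LinearMap.isSymmetric_iff_isSelfAdjoint X).1 hXs
  -- After passing to adjoints the contraction `X` acts last, so the comparison is term by term.
  rw [sum_norm_sq_apply_eq_adjoint c c (H ∘ₗ X), sum_norm_sq_apply_eq_adjoint c c H]
  refine sum_le_sum fun i _ => ?_
  rw [LinearMap.adjoint_comp, hXa]
  exact pow_le_pow_left₀ (norm_nonneg _) (hXle _) 2

/-- The noise bound for regularised reconstruction relative to an operator `A` with kernel spanned
by `u`, in terms of a doubly substochastic combination of ratios of eigenvalues. -/
theorem exists_substochastic_of_reconstruction {ι κ : Type*} [Fintype ι] [DecidableEq ι]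
    [Fintype κ] (b : OrthonormalBasis ι ℝ F) (ε : OrthonormalBasis κ ℝ F)
    {A E B : F →ₗ[ℝ] F} {μ : ℝ} (hμ : 0 < μ) (hA : A.IsSymmetric) {α : ι → ℝ}
    (hb : ∀ i, A (b i) = α i • b i) {o : ι} (hαo : α o = 0) {l h : ℝ} (hl0 : 0 < l) (hh0 : 0 < h)
    (hl : ∀ i ≠ o, l ≤ α i) (hh : ∀ i ≠ o, α i ≤ h)
    {u : F} {c : ℝ} (hc : c ≠ 0) (hu : u = c • b o)
    (hE : E.IsSymmetric) (hEE : ∀ x, E (E x) = E x) (hEu : E u ≠ 0)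
    (hB : ∀ x, E (B x) + μ • A (B x) = x) {p : ℕ}
    (htr : LinearMap.trace ℝ F E = p + 1) :
    ∃ d : ι → ι → ℝ, (∀ i j, 0 ≤ d i j) ∧ (∀ i j, d i j = d j i) ∧ (∀ j, d o j = 0) ∧
      (∀ i, ∑ j, d i j ≤ 1) ∧ (∑ i, ∑ j, d i j ≤ 2 * p) ∧
      ∑ i, ‖B (E (ε i))‖ ^ 2 ≤ (l + h) ^ 2 / (4 * l * h) * (‖u‖ ^ 2 / ‖E u‖ ^ 2) + p +
        (∑ i, ∑ j, d i j * (α j / α i - 1)) / 4 := by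
  have hα : ∀ i ≠ o, 0 < α i := fun i hi => hl0.trans_le (hl i hi)
  have hα' : ∀ i, 0 ≤ α i := fun i => by
    by_cases hi : i = o
    · rw [hi, hαo]
    · exact (hα i hi).le
  have hApos := inner_apply_self_nonneg_of_eigenvalues b hA hb hα'
  have hAu : A u = 0 := by rw [hu, map_smul, hb, hαo]; simp
  have hu0 : u ≠ 0 := by rintro rfl; simp at hEu
  have hN : 0 < ‖u‖ ^ 2 := by positivity
  have hm : 0 < ‖E u‖ ^ 2 := by positivity
  have hdef : ∀ x, ⟪A x, x⟫_ℝ = 0 → E x = 0 → x = 0 := fun x =>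
    eq_zero_of_inner_apply_self_eq_zero b hA hb hαo hα hc hu hEu
  obtain ⟨H, hEH, hHE, hEAH, hH⟩ := exists_harmonic_extension hE hEE hdef
  have hHu : H u = u := hH u (by rw [hAu, map_zero])
  have hHH : ∀ x, H (H x) = H x := fun x => hH _ (hEAH x)
  have hAH : ∀ x y, ⟪A (H x), y⟫_ℝ = ⟪A x, H y⟫_ℝ := by
    -- `A (H x)` lies in the range of `E`, so only `E y = E (H y)` matters.
    have key : ∀ x y, ⟪A (H x), y⟫_ℝ = ⟪A (H x), H y⟫_ℝ := fun x y => by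
      rw [← hEAH, hE, hE, hEH]
    intro x y
    rw [key, hA, real_inner_comm, ← key, hA, real_inner_comm, hA, real_inner_comm, hA,
      real_inner_comm]
  set q : F →ₗ[ℝ] F := (innerₛₗ ℝ u).smulRight u with hq
  have hqx : ∀ x, q x = ⟪u, x⟫_ℝ • u := fun x => rfl
  set P : F →ₗ[ℝ] F := H - (‖u‖ ^ 2)⁻¹ • q ∘ₗ H with hP
  have hPx : ∀ x, P x = H x - ((‖u‖ ^ 2)⁻¹ * ⟪u, H x⟫_ℝ) • u := fun x => by
    rw [hP, LinearMap.sub_apply, LinearMap.smul_apply, LinearMap.comp_apply, hqx, smul_smul]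
  have hPu : P u = 0 := by
    rw [hPx, hHu, real_inner_self_eq_norm_sq, inv_mul_cancel₀ hN.ne', one_smul, sub_self]
  have huP : ∀ x, ⟪u, P x⟫_ℝ = 0 := fun x => by
    rw [hPx, inner_sub_right, inner_smul_right, real_inner_self_eq_norm_sq]
    field_simp; ring
  have hPH : ∀ x, P (H x) = P x := fun x => by rw [hPx, hPx, hHH]
  have hPP : ∀ x, P (P x) = P x := fun x => by
    conv_lhs => rw [hPx x]
    rw [map_sub, map_smul, hPu, smul_zero, sub_zero, hPH]
  have hAP : ∀ x y, ⟪A (P x), y⟫_ℝ = ⟪A x, P y⟫_ℝ := by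
    intro x y
    rw [hPx, hPx, map_sub, map_smul, hAu, smul_zero, sub_zero, hAH, inner_sub_right,
      inner_smul_right, hA x u, hAu, inner_zero_right, mul_zero, sub_zero]
  have hbo : b o = c⁻¹ • u := by rw [hu, smul_smul, inv_mul_cancel₀ hc, one_smul]
  -- the rank of `P`
  have hHtr : LinearMap.trace ℝ F H = p + 1 := by
    rw [← htr, ← show H ∘ₗ E = H from LinearMap.ext hHE, LinearMap.trace_comp_comm',
      show E ∘ₗ H = E from LinearMap.ext hEH]
  have hqtr : LinearMap.trace ℝ F (q ∘ₗ H) = ‖u‖ ^ 2 := by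
    rw [LinearMap.trace_eq_sum_inner _ b]
    have : ∀ i, ⟪b i, (q ∘ₗ H) (b i)⟫_ℝ = ⟪H.adjoint u, b i⟫_ℝ * ⟪b i, u⟫_ℝ := fun i => by
      rw [LinearMap.comp_apply, hqx, inner_smul_right, LinearMap.adjoint_inner_left]
    simp_rw [this]
    rw [b.sum_inner_mul_inner, LinearMap.adjoint_inner_left, hHu, real_inner_self_eq_norm_sq]
  have hPtr : LinearMap.trace ℝ F P = p := by
    rw [hP, map_sub, map_smul, hHtr, hqtr, smul_eq_mul, inv_mul_cancel₀ hN.ne']; ring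
  have hrank : (Module.finrank ℝ (LinearMap.range P) : ℝ) = p := by
    have hid : IsIdempotentElem P := LinearMap.ext hPP
    rw [← hPtr, (LinearMap.IsIdempotentElem.isProj_range P hid).trace]
  obtain ⟨d, d0, ds, dO, drow, dtot, dle⟩ := exists_substochastic_of_projection b hA hb o hα hPP
    hAP (by rw [hbo, map_smul, hPu, smul_zero])
    (fun x => by rw [hbo, inner_smul_left, huP, mul_zero])
  rw [← LinearMap.trace_eq_sum_inner P b, hPtr] at dle
  rw [hrank] at dtot
  refine ⟨d, d0, ds, dO, drow, dtot, ?_⟩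
  have hle := sum_norm_sq_reconstruction_le ε hμ hA hApos hE hEE hB hHE hH
  -- split off the component along `u`
  set a := H.adjoint u with ha
  have hsplit : ∑ i, ‖H (ε i)‖ ^ 2 = ∑ i, ‖P (b i)‖ ^ 2 + ‖a‖ ^ 2 / ‖u‖ ^ 2 := by
    have h1 : ∀ x, ‖H x‖ ^ 2 = ‖P x‖ ^ 2 + ‖⟪a, x⟫_ℝ‖ ^ 2 / ‖u‖ ^ 2 := by
      intro x
      have : H x = P x + ((‖u‖ ^ 2)⁻¹ * ⟪u, H x⟫_ℝ) • u := by rw [hPx]; abel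
      rw [this, norm_add_sq_real, inner_smul_right, real_inner_comm u, huP, norm_smul, ha,
        LinearMap.adjoint_inner_left, mul_pow, norm_mul, mul_pow]
      simp only [norm_inv, norm_pow, Real.norm_eq_abs, sq_abs]
      field_simp
      ring
    simp_rw [h1]
    rw [sum_add_distrib, ← sum_div, ε.sum_sq_norm_inner_left,
      sum_norm_sq_apply_eq_adjoint ε ε P, ← sum_norm_sq_apply_eq_adjoint b ε P]
  -- the component along `u`, by Kantorovich's inequality
  set w := P.adjoint (E u) with hw
  -- The adjoint of `H` fixes `E u`, because `E ∘ H = E`.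
  have hwa : w = E u - (‖E u‖ ^ 2 / ‖u‖ ^ 2) • a := by
    refine ext_inner_right ℝ fun x => ?_
    rw [hw, LinearMap.adjoint_inner_left, hPx, inner_sub_right, inner_smul_right, inner_sub_left,
      inner_smul_left, ha, LinearMap.adjoint_inner_left, hE, hEH, ← hE, hE u u,
      ← hEE u, ← hE u, real_inner_self_eq_norm_sq, hEE]
    simp only [conj_trivial]
    ring
  have hEua : ⟪E u, a⟫_ℝ = ‖u‖ ^ 2 := by
    rw [ha, LinearMap.adjoint_inner_right, hHE, hHu, real_inner_self_eq_norm_sq]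
  have hwn : ‖w‖ ^ 2 = (‖E u‖ ^ 2 / ‖u‖ ^ 2) ^ 2 * ‖a‖ ^ 2 - ‖E u‖ ^ 2 := by
    rw [hwa, norm_sub_sq_real, inner_smul_right, hEua, norm_smul, mul_pow]
    simp only [norm_div, norm_pow, norm_norm]
    field_simp
    ring
  set r := (l + h) ^ 2 / (4 * l * h) with hr
  -- With `t = ‖A (P w)‖`, the quadratic inequality gives `4lh‖P w‖² ≤ 4(l + h)t‖w‖ - 4t²`, at most
  -- `(l + h)²‖w‖²` on completing the square.
  have hkant : ‖P w‖ ^ 2 ≤ r * ‖w‖ ^ 2 := by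
    have h1 := norm_sq_add_le_mul_inner b hA hb hl hh
      (x := P w) (by rw [hbo, inner_smul_left, huP, mul_zero])
    have h2 : ⟪A (P w), P w⟫_ℝ ≤ ‖A (P w)‖ * ‖w‖ := by
      rw [← hAP, hPP]; exact real_inner_le_norm _ _
    have h3 : ‖A (P w)‖ ^ 2 + l * h * ‖P w‖ ^ 2 ≤ (l + h) * (‖A (P w)‖ * ‖w‖) :=
      h1.trans (mul_le_mul_of_nonneg_left h2 (by positivity))
    rw [hr, div_mul_eq_mul_div, le_div_iff₀ (by positivity)]
    nlinarith [sq_nonneg (2 * ‖A (P w)‖ - (l + h) * ‖w‖)]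
  -- `E u` is orthogonal to `w`, so pairing it with `P w - w` rather than `P w` loses nothing and
  -- improves the constant from `r` to `r - 1`.
  have hww : ‖w‖ ^ 2 ≤ (r - 1) * ‖E u‖ ^ 2 := by
    have h1 : ⟪P w, w⟫_ℝ = ‖w‖ ^ 2 := by
      conv_lhs => rw [hw, LinearMap.adjoint_inner_right, hPP, ← LinearMap.adjoint_inner_right,
        ← hw, real_inner_self_eq_norm_sq]
    have h2 : ⟪E u, P w⟫_ℝ = ‖w‖ ^ 2 := by
      rw [← LinearMap.adjoint_inner_left, ← hw, real_inner_self_eq_norm_sq]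
    have hPEu : P (E u) = 0 := by
      rw [← hPu, hPx, hPx, hHE]
    have h3 : ⟪E u, w⟫_ℝ = 0 := by
      rw [hw, LinearMap.adjoint_inner_right, hPEu, inner_zero_left]
    have h4 : ‖P w - w‖ ^ 2 ≤ (r - 1) * ‖w‖ ^ 2 := by
      rw [norm_sub_sq_real, h1]; linarith
    have h5 : ‖w‖ ^ 2 ≤ ‖E u‖ * ‖P w - w‖ := by
      have := real_inner_le_norm (E u) (P w - w)
      rwa [inner_sub_right, h2, h3, sub_zero] at this
    have h6 : (‖w‖ ^ 2) ^ 2 ≤ ‖E u‖ ^ 2 * ((r - 1) * ‖w‖ ^ 2) := by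
      calc (‖w‖ ^ 2) ^ 2 ≤ (‖E u‖ * ‖P w - w‖) ^ 2 := by gcongr
        _ = ‖E u‖ ^ 2 * ‖P w - w‖ ^ 2 := by ring
        _ ≤ _ := by gcongr
    have h7 : 0 ≤ r - 1 := by
      have : r - 1 = (h - l) ^ 2 / (4 * l * h) := by rw [hr]; field_simp; ring
      rw [this]; positivity
    rcases (sq_nonneg ‖w‖).eq_or_lt with h0 | h0
    · rw [← h0]; positivity
    · nlinarith
  have hafin : ‖a‖ ^ 2 / ‖u‖ ^ 2 ≤ r * (‖u‖ ^ 2 / ‖E u‖ ^ 2) := by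
    have : ‖a‖ ^ 2 = (‖w‖ ^ 2 + ‖E u‖ ^ 2) * (‖u‖ ^ 2 / ‖E u‖ ^ 2) ^ 2 := by
      rw [hwn]; field_simp; ring
    rw [this]
    have h1 : ‖w‖ ^ 2 + ‖E u‖ ^ 2 ≤ r * ‖E u‖ ^ 2 := by linarith
    calc _ ≤ (r * ‖E u‖ ^ 2) * (‖u‖ ^ 2 / ‖E u‖ ^ 2) ^ 2 / ‖u‖ ^ 2 := by gcongr
      _ = _ := by field_simp
  linarith
end

/-! ### The Kantorovich function -/

theorem kantorovichOmega_eq {x : ℝ} (hx : 0 < x) :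
    kantorovichOmega x = 1 / 4 * (x + 1 / x + 2) := by
  have h := Real.sq_sqrt hx.le
  have h' : √x ≠ 0 := (Real.sqrt_pos.2 hx).ne'
  rw [kantorovichOmega, add_sq, div_pow, h]
  field_simp
  ring

theorem kantorovichOmega_div {x y : ℝ} (hx : 0 < x) (hy : 0 < y) :
    kantorovichOmega (x / y) = (y + x) ^ 2 / (4 * y * x) := by
  rw [kantorovichOmega_eq (div_pos hx hy)]
  field_simp
  ring

theorem kantorovichOmega_one : kantorovichOmega 1 = 1 := by
  rw [kantorovichOmega_eq one_pos]; norm_num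

theorem kantorovichOmega_le {x y : ℝ} (hx : 1 ≤ x) (hxy : x ≤ y) :
    kantorovichOmega x ≤ kantorovichOmega y := by
  have hx0 : 0 < x := by linarith
  have hy0 : 0 < y := by linarith
  rw [kantorovichOmega_eq hx0, kantorovichOmega_eq hy0]
  have : (y + 1 / y) - (x + 1 / x) = (y - x) * (x * y - 1) / (x * y) := by
    field_simp; ring
  have h2 : 0 ≤ (y - x) * (x * y - 1) / (x * y) :=
    div_nonneg (mul_nonneg (by linarith) (by nlinarith)) (by positivity)
  linarith

/-- The number of the form `x + 1/x - 2` cut off below `x = 1`. -/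
theorem four_mul_kantorovichOmega_max_sub_one {x y : ℝ} (hx : 0 < x) (hy : 0 < y) {q : Prop}
    [Decidable q] (h : q → y ≤ x) (h' : ¬ q → x ≤ y) :
    4 * (kantorovichOmega (max 1 (x / y)) - 1) = if q then x / y + y / x - 2 else 0 := by
  split_ifs with hq
  · rw [max_eq_right ((one_le_div hy).2 (h hq)), kantorovichOmega_eq (div_pos hx hy), one_div_div]
    ring
  · rw [max_eq_left ((div_le_one hy).2 (h' hq)), kantorovichOmega_one]; ring

/-! ### Spectrum of the Laplacian and the reconstruction matrix -/

namespace WeightedGraph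

/-- The constant vector `1`. -/
noncomputable def ones (V : Type*) : EuclideanSpace ℝ V := WithLp.toLp 2 fun _ => 1

theorem norm_sq_ones {V : Type*} [Fintype V] : ‖ones V‖ ^ 2 = Fintype.card V := by
  simp [EuclideanSpace.norm_sq_eq, ones]

variable {V : Type*} [Fintype V] [DecidableEq V] (G : WeightedGraph V)

open scoped InnerProductSpace
open Matrix

theorem laplacian_mulVec_apply (x : V → ℝ) (i : V) :
    (G.laplacian *ᵥ x) i = ∑ j, G.weight i j * (x i - x j) := by
  rw [laplacian, Matrix.sub_mulVec, Pi.sub_apply, Matrix.mulVec_diagonal, Matrix.mulVec,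
    dotProduct, sum_mul, ← sum_sub_distrib]
  exact sum_congr rfl fun j _ => by ring

theorem dotProduct_laplacian_mulVec (x : V → ℝ) :
    x ⬝ᵥ (G.laplacian *ᵥ x) = (∑ i, ∑ j, G.weight i j * (x i - x j) ^ 2) / 2 := by
  have h1 : x ⬝ᵥ (G.laplacian *ᵥ x) = ∑ i, ∑ j, x i * (G.weight i j * (x i - x j)) := by
    simp_rw [dotProduct, laplacian_mulVec_apply, mul_sum]
  have h2 : x ⬝ᵥ (G.laplacian *ᵥ x) = ∑ i, ∑ j, -x j * (G.weight i j * (x i - x j)) := by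
    rw [h1, sum_comm]
    refine sum_congr rfl fun i _ => sum_congr rfl fun j _ => ?_
    rw [G.symm.apply j i]
    ring
  rw [eq_div_iff two_ne_zero, mul_two]
  nth_rewrite 1 [h1]
  rw [h2, ← sum_add_distrib]
  refine sum_congr rfl fun i _ => ?_
  rw [← sum_add_distrib]
  exact sum_congr rfl fun j _ => by ring

/-- The Laplacian as an operator on Euclidean space. -/
noncomputable abbrev laplacianOp : EuclideanSpace ℝ V →ₗ[ℝ] EuclideanSpace ℝ V :=
  Matrix.toEuclideanLin G.laplacian

theorem laplacianOp_isSymmetric : G.laplacianOp.IsSymmetric :=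
  Matrix.isSymmetric_toEuclideanLin_iff.mpr G.laplacian_isHermitian

/-- An orthonormal eigenbasis of the Laplacian, in the order of decreasing eigenvalues. -/
noncomputable def eigenbasis : OrthonormalBasis (Fin (Fintype.card V)) ℝ (EuclideanSpace ℝ V) :=
  G.laplacianOp_isSymmetric.eigenvectorBasis finrank_euclideanSpace

theorem eig_of_lt {k : ℕ} (hk : k < Fintype.card V) :
    G.eig (Fintype.card V - k) = G.laplacian_isHermitian.eigenvalues₀ ⟨k, hk⟩ := by
  rw [eig, dif_pos (by omega)]
  congr 2; omega

theorem laplacianOp_eigenbasis (i : Fin (Fintype.card V)) :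
    G.laplacianOp (G.eigenbasis i) = G.eig (Fintype.card V - i) • G.eigenbasis i := by
  rw [G.eig_of_lt i.2]
  exact G.laplacianOp_isSymmetric.apply_eigenvectorBasis finrank_euclideanSpace i

theorem eig_mono {j k : ℕ} (hj : 1 ≤ j) (hjk : j ≤ k) (hk : k ≤ Fintype.card V) :
    G.eig j ≤ G.eig k := by
  rw [eig, dif_pos ⟨hj, hjk.trans hk⟩, eig, dif_pos ⟨hj.trans hjk, hk⟩]
  exact G.laplacian_isHermitian.eigenvalues₀_antitone (Fin.mk_le_mk.2 (by omega))

theorem eq_of_laplacian_dotProduct_eq_zero (hconn : G.support.Connected)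
    (hw : ∀ i j, 0 ≤ G.weight i j) {x : V → ℝ} (hx : x ⬝ᵥ (G.laplacian *ᵥ x) = 0) (i j : V) :
    x i = x j := by
  rw [dotProduct_laplacian_mulVec, div_eq_zero_iff, or_iff_left two_ne_zero,
    sum_eq_zero_iff_of_nonneg fun i _ => sum_nonneg fun j _ =>
      mul_nonneg (hw i j) (sq_nonneg _)] at hx
  have hadj : ∀ a b, G.support.Adj a b → x a = x b := by
    intro a b hab
    have := hx a (mem_univ _)
    rw [sum_eq_zero_iff_of_nonneg fun j _ => mul_nonneg (hw a j) (sq_nonneg _)] at this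
    have := (mul_eq_zero.1 (this b (mem_univ _))).resolve_left hab
    rw [pow_eq_zero_iff two_ne_zero] at this
    linarith
  obtain ⟨p⟩ := hconn.preconnected i j
  induction p with
  | nil => rfl
  | cons h _ ih => rw [hadj _ _ h, ih]

/-- If `λ₂ ≤ 0`, the eigenvectors for `λ₁` and `λ₂` have zero Dirichlet energy, so both are constant
by connectedness; two non-zero constant vectors are not orthogonal. -/
theorem eig_two_pos_of_weight_nonneg (hN : 2 ≤ Fintype.card V) (hconn : G.support.Connected)
    (hw : ∀ i j, 0 ≤ G.weight i j) : 0 < G.eig 2 := by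
  have hpos : ∀ x : EuclideanSpace ℝ V, ⟪x, G.laplacianOp x⟫_ℝ =
      x.ofLp ⬝ᵥ (G.laplacian *ᵥ x.ofLp) :=
    fun x => by simp [EuclideanSpace.inner_eq_star_dotProduct, dotProduct_comm]
  have hval : ∀ i, (G.eigenbasis i).ofLp ⬝ᵥ (G.laplacian *ᵥ (G.eigenbasis i).ofLp) =
      G.eig (Fintype.card V - i) := fun i => by
    rw [← hpos, laplacianOp_eigenbasis, inner_smul_right, real_inner_self_eq_norm_sq,
      G.eigenbasis.orthonormal.1 i]
    simp
  have hnn : ∀ i : Fin (Fintype.card V), 0 ≤ G.eig (Fintype.card V - i) := fun i => by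
    rw [← hval, dotProduct_laplacian_mulVec]
    exact div_nonneg (sum_nonneg fun i _ => sum_nonneg fun j _ =>
      mul_nonneg (hw i j) (sq_nonneg _)) zero_le_two
  by_contra h2
  have hconst : ∀ i : Fin (Fintype.card V), Fintype.card V - i ≤ 2 →
      ∀ v w, (G.eigenbasis i).ofLp v = (G.eigenbasis i).ofLp w := by
    intro i hi
    refine G.eq_of_laplacian_dotProduct_eq_zero hconn hw ?_
    rw [hval]
    refine le_antisymm ?_ (hnn i)
    exact (G.eig_mono (by omega) hi hN).trans (not_lt.1 h2)
  set i : Fin (Fintype.card V) := ⟨Fintype.card V - 2, by omega⟩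
  set j : Fin (Fintype.card V) := ⟨Fintype.card V - 1, by omega⟩
  have hi := hconst i (by simp only [i]; omega)
  have hj := hconst j (by simp only [j]; omega)
  have hij : i ≠ j := by simp only [i, j, ne_eq, Fin.mk.injEq]; omega
  obtain ⟨v⟩ := hconn.nonempty
  have hne : ∀ k, (∀ a b, (G.eigenbasis k).ofLp a = (G.eigenbasis k).ofLp b) →
      (G.eigenbasis k).ofLp v ≠ 0 := by
    intro k hk h0
    have h1 := G.eigenbasis.orthonormal.1 k
    have : G.eigenbasis k = 0 := by
      ext a; rw [hk a v, h0]; rfl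
    rw [this, norm_zero] at h1
    exact zero_ne_one h1
  have horth : ⟪G.eigenbasis i, G.eigenbasis j⟫_ℝ = 0 := G.eigenbasis.orthonormal.2 hij
  rw [EuclideanSpace.inner_eq_star_dotProduct, dotProduct,
    sum_congr rfl fun a _ => by rw [hj a v, Pi.star_apply, hi a v], sum_const, nsmul_eq_mul] at horth
  have hcard : (#(univ : Finset V) : ℝ) ≠ 0 := by rw [card_univ]; positivity
  exact mul_ne_zero hcard (mul_ne_zero (hne j hj) (by simpa using hne i hi)) horth

/-- The coordinate projection onto `S` as an operator on Euclidean space. -/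
noncomputable def coordProj (S : Finset V) : EuclideanSpace ℝ V →ₗ[ℝ] EuclideanSpace ℝ V :=
  Matrix.toEuclideanLin (Matrix.diagonal fun i => if i ∈ S then (1 : ℝ) else 0)

theorem coordProj_apply (S : Finset V) (x : EuclideanSpace ℝ V) (i : V) :
    coordProj S x i = if i ∈ S then x i else 0 := by
  simp [coordProj, Matrix.mulVec_diagonal]

theorem coordProj_single (S : Finset V) (v : V) :
    coordProj S (EuclideanSpace.single v 1) =
      if v ∈ S then EuclideanSpace.single v (1 : ℝ) else 0 := by
  ext i
  rw [coordProj_apply]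
  by_cases h : i = v
  · subst h; split_ifs <;> simp
  · split_ifs <;> simp [h]

theorem coordProj_isSymmetric (S : Finset V) : (coordProj S).IsSymmetric :=
  Matrix.isSymmetric_toEuclideanLin_iff.mpr (Matrix.isHermitian_diagonal _)

theorem trace_coordProj (S : Finset V) : LinearMap.trace ℝ _ (coordProj S) = #S := by
  rw [LinearMap.trace_eq_sum_inner _ (EuclideanSpace.basisFun V ℝ)]
  have : ∀ v, ⟪EuclideanSpace.basisFun V ℝ v, coordProj S (EuclideanSpace.basisFun V ℝ v)⟫_ℝ =
      if v ∈ S then 1 else 0 := fun v => by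
    rw [EuclideanSpace.basisFun_apply, coordProj_single]
    split_ifs <;> simp
  simp_rw [this]
  simp

theorem norm_sq_coordProj_ones (S : Finset V) : ‖coordProj S (ones V)‖ ^ 2 = #S := by
  rw [EuclideanSpace.norm_sq_eq]
  simp_rw [coordProj_apply]
  simp [ones, apply_ite]

theorem laplacianOp_ones : G.laplacianOp (ones V) = 0 := by
  ext i
  change (G.laplacian *ᵥ fun _ => (1 : ℝ)) i = 0
  rw [laplacian_mulVec_apply]
  simp

/-- The constant vector is in the kernel, hence orthogonal to every eigenvector of positive
eigenvalue; only the last one remains. Semidefiniteness is not needed, and `λ₁ = 0` follows. -/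
theorem exists_ones_eq_smul_eigenbasis (hN : 2 ≤ Fintype.card V) (h2 : 0 < G.eig 2) :
    ∃ c : ℝ, c ≠ 0 ∧ ones V = c • G.eigenbasis ⟨Fintype.card V - 1, by omega⟩ := by
  set o : Fin (Fintype.card V) := ⟨Fintype.card V - 1, by omega⟩ with ho
  have h1 : ones V = ⟪G.eigenbasis o, ones V⟫_ℝ • G.eigenbasis o := by
    conv_lhs => rw [← G.eigenbasis.sum_repr' (ones V)]
    refine sum_eq_single o (fun i _ hi => ?_) (by simp)
    have hio : (i : ℕ) ≠ Fintype.card V - 1 := fun h => hi (Fin.ext h)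
    have h3 := G.laplacianOp_isSymmetric (G.eigenbasis i) (ones V)
    rw [laplacianOp_ones, inner_zero_right, laplacianOp_eigenbasis, inner_smul_left] at h3
    have h4 : 0 < G.eig (Fintype.card V - i) :=
      h2.trans_le (G.eig_mono (by omega) (by omega) (by omega))
    have h5 := (mul_eq_zero.1 h3).resolve_left (by simpa using h4.ne')
    rw [h5, zero_smul]
  refine ⟨_, ?_, h1⟩
  intro h0
  rw [h0, zero_smul] at h1
  have := norm_sq_ones (V := V)
  rw [h1, norm_zero] at this
  have : (0 : ℝ) < Fintype.card V := by exact_mod_cast (by omega : 0 < Fintype.card V)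
  simp_all

theorem eig_one_eq_zero (hN : 2 ≤ Fintype.card V) (h2 : 0 < G.eig 2) : G.eig 1 = 0 := by
  obtain ⟨c, hc, hu⟩ := G.exists_ones_eq_smul_eigenbasis hN h2
  have h := G.laplacianOp_ones
  rw [hu, map_smul, laplacianOp_eigenbasis, smul_smul, smul_eq_zero] at h
  have h' := (mul_eq_zero.1 (h.resolve_right (G.eigenbasis.orthonormal.ne_zero _))).resolve_left hc
  rwa [show Fintype.card V - (Fintype.card V - 1) = 1 by omega] at h'

/-- The regularised system matrix `Π_S + μ L` is invertible. -/
theorem isUnit_det_reconstruction (hN : 2 ≤ Fintype.card V) (h2 : 0 < G.eig 2) {μ : ℝ}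
    (hμ : 0 < μ) {S : Finset V} (hS : S.Nonempty) :
    IsUnit (Matrix.diagonal (fun i => if i ∈ S then (1 : ℝ) else 0) + μ • G.laplacian).det := by
  rw [← Matrix.isUnit_iff_isUnit_det, ← Matrix.mulVec_injective_iff_isUnit]
  obtain ⟨c, hc, hu⟩ := G.exists_ones_eq_smul_eigenbasis hN h2
  set M := Matrix.diagonal (fun i => if i ∈ S then (1 : ℝ) else 0) + μ • G.laplacian with hM
  -- Pairing the equation with `x` gives `‖E x‖² + μ⟪A x, x⟫ = 0`; both terms vanish, and no
  -- non-zero constant vanishes on `S`.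
  have key : ∀ x : EuclideanSpace ℝ V, coordProj S x + μ • G.laplacianOp x = 0 → x = 0 := by
    intro x hx
    have hα : ∀ i : Fin (Fintype.card V), i ≠ ⟨Fintype.card V - 1, by omega⟩ →
        0 < G.eig (Fintype.card V - i) := fun i hi => by
      have hio : (i : ℕ) ≠ Fintype.card V - 1 := fun h => hi (Fin.ext h)
      exact h2.trans_le (G.eig_mono (by omega) (by omega) (by omega))
    have hα0 : G.eig (Fintype.card V - (Fintype.card V - 1)) = 0 := by
      rw [show Fintype.card V - (Fintype.card V - 1) = 1 by omega, G.eig_one_eq_zero hN h2]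
    have hE : ⟪coordProj S x, x⟫_ℝ = ‖coordProj S x‖ ^ 2 := by
      rw [← real_inner_self_eq_norm_sq, ← coordProj_isSymmetric]
      congr 1
      ext i; simp only [coordProj_apply]; split_ifs <;> rfl
    have hnn := inner_apply_self_nonneg_of_eigenvalues G.eigenbasis G.laplacianOp_isSymmetric
      G.laplacianOp_eigenbasis (fun i => by
        by_cases hi : i = ⟨Fintype.card V - 1, by omega⟩
        · rw [hi, hα0]
        · exact (hα i hi).le) x
    have h0 := congrArg (fun y => ⟪y, x⟫_ℝ) hx
    simp only [inner_add_left, inner_smul_left, inner_zero_left, hE, conj_trivial] at h0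
    have h3 := mul_nonneg hμ.le hnn
    have h4 := sq_nonneg ‖coordProj S x‖
    refine eq_zero_of_inner_apply_self_eq_zero G.eigenbasis (E := coordProj S)
      G.laplacianOp_isSymmetric G.laplacianOp_eigenbasis hα0 hα hc hu ?_ ?_ ?_
    · intro h
      have := norm_sq_coordProj_ones S
      rw [h, norm_zero] at this
      have : (0 : ℝ) < #S := by exact_mod_cast hS.card_pos
      simp_all
    · have : μ * ⟪G.laplacianOp x, x⟫_ℝ = 0 := by linarith
      exact (mul_eq_zero.1 this).resolve_left hμ.ne'
    · have : ‖coordProj S x‖ ^ 2 = 0 := by linarith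
      simpa using this
  intro x y hxy
  have h := key (WithLp.toLp 2 (x - y)) (by
    rw [coordProj, laplacianOp, ← LinearMap.smul_apply, ← map_smul, ← LinearMap.add_apply,
      ← map_add, ← hM]
    ext i
    change (M *ᵥ (x - y)) i = 0
    rw [Matrix.mulVec_sub, Pi.sub_apply]
    exact sub_eq_zero.2 (congrFun hxy i))
  have h' : x - y = 0 := congrArg WithLp.ofLp h
  exact sub_eq_zero.1 h'

theorem noiseSensitivity_eq_sum (μ : ℝ) (S : Finset V) : G.noiseSensitivity μ S =
    ∑ v, ‖Matrix.toEuclideanLin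
      (Matrix.diagonal (fun i => if i ∈ S then (1 : ℝ) else 0) + μ • G.laplacian)⁻¹
      (coordProj S (EuclideanSpace.basisFun V ℝ v))‖ ^ 2 := by
  set T := (Matrix.diagonal (fun i => if i ∈ S then (1 : ℝ) else 0) + μ • G.laplacian)⁻¹ with hT
  have h1 : ∀ v, ‖Matrix.toEuclideanLin T (coordProj S (EuclideanSpace.basisFun V ℝ v))‖ ^ 2 =
      if v ∈ S then ∑ i, T i v ^ 2 else 0 := fun v => by
    rw [EuclideanSpace.basisFun_apply, coordProj_single]
    split_ifs
    · rw [EuclideanSpace.norm_sq_eq]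
      refine sum_congr rfl fun i _ => ?_
      simp [Matrix.toLpLin_apply]
    · simp
  simp_rw [h1]
  rw [← sum_filter, filter_mem_eq_inter, univ_inter, noiseSensitivity, sum_comm,
    ← sum_coe_sort S]
  rfl

end WeightedGraph

/-! ### The noise bound -/

theorem lemma5 {V : Type*} [Fintype V] [DecidableEq V] (G : WeightedGraph V)
    (hN : 2 ≤ Fintype.card V)
    (hconn : G.support.Connected)
    (hw : (∀ i j, 0 ≤ G.weight i j) ∨ (G.laplacian.PosSemidef ∧ 0 < G.eig 2))
    (μ : ℝ) (hμ : 0 < μ)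
    (S : Finset V) (hS : S.Nonempty) (N m : ℕ) (hNV : N = Fintype.card V) (hm : m = S.card)
    (r : ℝ) (hr : r = kantorovichOmega (G.eig N / G.eig 2)) :
    G.noiseSensitivity μ S ≤
        r * ((N : ℝ) / (m : ℝ)) +
          ∑ i ∈ Finset.Icc 2 m, kantorovichOmega (max 1 (G.eig (N + 2 - i) / G.eig i)) ∧
      r * ((N : ℝ) / (m : ℝ)) +
          ∑ i ∈ Finset.Icc 2 m, kantorovichOmega (max 1 (G.eig (N + 2 - i) / G.eig i)) ≤
        r * ((N : ℝ) / (m : ℝ)) + r * ((m : ℝ) - 1) := by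
  have h2 : 0 < G.eig 2 := by
    rcases hw with hw | hw
    · exact G.eig_two_pos_of_weight_nonneg hN hconn hw
    · exact hw.2
  have hm1 : 1 ≤ m := hm ▸ hS.card_pos
  have hmN : m ≤ N := by rw [hm, hNV]; exact card_le_univ S
  have hmono : ∀ {j k : ℕ}, 1 ≤ j → j ≤ k → k ≤ N → G.eig j ≤ G.eig k := fun h1 h2 h3 =>
    G.eig_mono h1 h2 (hNV ▸ h3)
  have hpos : ∀ k, 2 ≤ k → k ≤ N → 0 < G.eig k := fun k h h' =>
    h2.trans_le (hmono one_le_two h h')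
  have hNpos : 0 < G.eig N := hpos N (hNV ▸ hN) le_rfl
  obtain ⟨p, rfl⟩ : ∃ p, m = p + 1 := ⟨m - 1, by omega⟩
  obtain ⟨n, rfl⟩ : ∃ n, N = n + 1 := ⟨N - 1, by omega⟩
  have hreindex : ∀ f : ℕ → ℝ, ∑ i ∈ Icc 2 (p + 1), f i = ∑ l ∈ range p, f (l + 2) := by
    intro f
    rw [range_eq_Ico, sum_Ico_add', zero_add]
    rfl
  constructor
  swap
  -- Each ratio is at most `λ_N / λ_2`, and `ω` increases on `[1, ∞)`.
  · have : ∀ i ∈ Icc 2 (p + 1), kantorovichOmega (max 1 (G.eig (n + 1 + 2 - i) / G.eig i)) ≤ r := by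
      intro i hi
      have hi := mem_Icc.1 hi
      rw [hr]
      refine kantorovichOmega_le (le_max_left _ _) (max_le ?_ ?_)
      · rw [one_le_div h2]; exact hmono one_le_two (by omega) le_rfl
      · exact div_le_div₀ hNpos.le (hmono (by omega) (by omega) le_rfl) h2
          (hmono one_le_two hi.1 (by omega))
    have := sum_le_card_nsmul _ _ _ this
    rw [Nat.card_Icc, nsmul_eq_mul, show p + 1 + 1 - 2 = p by omega] at this
    push_cast
    linarith
  set o : Fin (Fintype.card V) := ⟨Fintype.card V - 1, by omega⟩ with ho
  obtain ⟨c, hc, hu⟩ := G.exists_ones_eq_smul_eigenbasis hN h2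
  have hEu : WeightedGraph.coordProj S (WeightedGraph.ones V) ≠ 0 := by
    intro h
    have h' := WeightedGraph.norm_sq_coordProj_ones S
    rw [h, norm_zero, ← hm] at h'
    have : (0 : ℝ) < (p + 1 : ℕ) := by positivity
    simp_all
  obtain ⟨d, d0, ds, dO, drow, dtot, dle⟩ := exists_substochastic_of_reconstruction
    G.eigenbasis (EuclideanSpace.basisFun V ℝ) (E := WeightedGraph.coordProj S)
    (B := Matrix.toEuclideanLin
      (Matrix.diagonal (fun i => if i ∈ S then (1 : ℝ) else 0) + μ • G.laplacian)⁻¹) hμ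
    G.laplacianOp_isSymmetric G.laplacianOp_eigenbasis (o := o)
    (by rw [ho, show Fintype.card V - (Fintype.card V - 1) = 1 by omega, G.eig_one_eq_zero hN h2])
    h2 hNpos
    (fun i hi => by
      have hio : (i : ℕ) ≠ Fintype.card V - 1 := fun h => hi (Fin.ext h)
      exact G.eig_mono (by omega) (by omega) (by omega))
    (fun i _ => G.eig_mono (by omega) (by omega) (by omega))
    hc hu (WeightedGraph.coordProj_isSymmetric S)
    (fun x => by ext i; simp only [WeightedGraph.coordProj_apply]; split_ifs <;> rfl) hEu
    (fun x => by
      have := G.isUnit_det_reconstruction hN h2 hμ hS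
      rw [WeightedGraph.coordProj, ← LinearMap.smul_apply, ← map_smul, ← LinearMap.add_apply, ← map_add]
      rw [Matrix.toLpLin_apply, Matrix.toLpLin_apply, Matrix.mulVec_mulVec,
        Matrix.mul_nonsing_inv _ this, Matrix.one_mulVec])
    (p := p) (by rw [WeightedGraph.trace_coordProj, ← hm]; push_cast; rfl)
  rw [← WeightedGraph.noiseSensitivity_eq_sum, WeightedGraph.norm_sq_ones, WeightedGraph.norm_sq_coordProj_ones, ← hm,
    ← kantorovichOmega_div hNpos h2, ← hr] at dle
  -- For `k < n = N - 1` this lists `λ_N, …, λ_2`; the remaining index `n` is the kernel, where the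
  -- weights vanish.
  set β : ℕ → ℝ := fun k => G.eig (n + 1 - k) with hβ
  set d' : ℕ → ℕ → ℝ := fun i j => if h : i < Fintype.card V ∧ j < Fintype.card V then
    d ⟨i, h.1⟩ ⟨j, h.2⟩ else 0 with hd'
  have hdd : ∀ i j : Fin (Fintype.card V), d i j = d' i j := fun i j => by
    simp only [hd']; rw [dif_pos ⟨i.2, j.2⟩]
  have d'0 : ∀ i j, 0 ≤ d' i j := fun i j => by
    simp only [hd']; split_ifs
    · exact d0 _ _
    · exact le_rfl
  have d's : ∀ i j, d' i j = d' j i := fun i j => by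
    by_cases h : i < Fintype.card V ∧ j < Fintype.card V
    · simp only [hd']; rw [dif_pos h, dif_pos h.symm, ds]
    · simp only [hd']; rw [dif_neg h, dif_neg fun h' => h h'.symm]
  have d'O : ∀ j, d' n j = 0 := fun j => by
    simp only [hd']; split_ifs with h
    · have : (⟨n, h.1⟩ : Fin (Fintype.card V)) = o := Fin.ext (by simp only [ho]; omega)
      rw [this, dO]
    · rfl
  have d'O' : ∀ j, d' j n = 0 := fun j => by rw [d's, d'O]
  have hsum1 : ∀ f : ℕ → ℝ, ∑ i : Fin (Fintype.card V), f i = ∑ i ∈ range (n + 1), f i := by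
    intro f; rw [Fin.sum_univ_eq_sum_range, hNV]
  have hsum2 : ∀ f : ℕ → ℕ → ℝ, ∑ i : Fin (Fintype.card V), ∑ j : Fin (Fintype.card V),
      d i j * f i j = ∑ i ∈ range n, ∑ j ∈ range n, d' i j * f i j := by
    intro f
    simp_rw [hdd]
    have hin : ∀ i : Fin (Fintype.card V), ∑ j : Fin (Fintype.card V), d' i j * f i j =
        ∑ j ∈ range (n + 1), d' i j * f i j := fun i => hsum1 fun j => d' i j * f i j
    simp_rw [hin]
    rw [hsum1 fun i => ∑ j ∈ range (n + 1), d' i j * f i j, sum_range_succ]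
    simp_rw [d'O, sum_range_succ, d'O']
    simp
  have hcomb := sum_mul_ratio_sub_one_le (n := n) (p := p) (by omega) β d'
    (fun i hi => hpos _ (by omega) (by omega))
    (fun i j hij hj => hmono (by omega) (by omega) (by omega)) d'0 d's
    (fun i hi => by
      have := drow ⟨i, by omega⟩
      simp_rw [hdd] at this
      rw [hsum1 fun j => d' i j, sum_range_succ, d'O', add_zero] at this
      exact this)
    (by
      have := hsum2 fun _ _ => 1
      simp only [mul_one] at this
      rwa [this] at dtot)
  have hα : ∑ i, ∑ j, d i j * (G.eig (Fintype.card V - j) / G.eig (Fintype.card V - i) - 1) =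
      ∑ i ∈ range n, ∑ j ∈ range n, d' i j * (β j / β i - 1) := by
    rw [← hsum2 fun i j => β j / β i - 1]
    simp only [hβ, hNV]
  rw [hα, show (Fintype.card V : ℝ) = (n + 1 : ℕ) by rw [hNV]] at dle
  -- The partner of `β l = λ_{N-l}` is `β (n - 1 - l) = λ_{l+2}`, so `i = l + 2`; pairs past the
  -- middle have `max = 1` and contribute `0`.
  have hterm : ∑ l ∈ range p, (if l ≤ n - 1 - l then
        β l / β (n - 1 - l) + β (n - 1 - l) / β l - 2 else 0) =
      4 * (∑ i ∈ Icc 2 (p + 1), kantorovichOmega (max 1 (G.eig (n + 1 + 2 - i) / G.eig i)) - p) := by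
    have hp : (p : ℝ) = ∑ l ∈ range p, (1 : ℝ) := by simp
    rw [hreindex, hp, ← sum_sub_distrib, mul_sum]
    refine sum_congr rfl fun l hl => ?_
    have hl := mem_range.1 hl
    have e1 : β l = G.eig (n + 1 + 2 - (l + 2)) := by
      simp only [hβ]; congr 1; omega
    have e2 : β (n - 1 - l) = G.eig (l + 2) := by
      simp only [hβ]; congr 1; omega
    rw [e1, e2]
    refine (four_mul_kantorovichOmega_max_sub_one (hpos _ (by omega) (by omega))
      (hpos _ (by omega) (by omega)) (fun h => hmono (by omega) (by omega) (by omega))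
      (fun h => hmono (by omega) (by omega) (by omega))).symm
  rw [hterm] at hcomb
  linarith
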